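/- Let $k$ be a field, $n\ge 0$, and let $M$ be a matroid on $[n]=\{1,\dots,n\}$ with no loops and no coloops. Let $W\subseteq k^{n}$ be a linear subspace that realizes $M$: for every $B\subseteq[n]$, the coordinate projection $W\to k^{B}$ is an isomorphism if and only if $B$ is a basis of $M$. Let $W^\perp=\{y\in k^n : \sum_i y_iw_i=0 \text{ for all } w\in W\}\cong (k^n/W)^*$. Let $R=k[W]=\operatorname{Sym}(W^*)$ and $R^\perp=k[W^\perp]=\operatorname{Sym}((W^\perp)^*)$ be the coordinate rings, and let $f_i\in R$ and $g_i\in R^\perp$ be the restrictions of the $i$-th coordinate function to $W$ and to $W^\perp$. Let $S=R\otimes_k R^\perp$ with its natural bigrading, let $\mathfrak a=(f_1g_1,\dots,f_ng_n)\subseteq S$ (the ideal of pairs), and let $(S/\mathfrak a)_{(\cdot,1)}$ be the $R$-module $\bigoplus_{i\ge 0}(S/\mathfrak a)_{(i,1)}$, that is, the image of $R\otimes_k (R^\perp)_1$ in $S/\mathfrak a$. For $F\subseteq[n]$ let $P_F=(f_i : i\in F)\subseteq R$. A flat of $M$ is called cyclic if it is a (possibly empty) union of circuits of $M$. Then: (a)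 every associated prime of the $R$-module $(S/\mathfrak a)_{(\cdot,1)}$ is equal to $P_F$ for some nonempty flat $F$ of $M$; (b) the set of minimal primes of the $R$-module $(S/\mathfrak a)_{(\cdot,1)}$ (the primes minimal over its annihilator) is exactly the set of ideals $P_F$ with $F$ a minimal element, under inclusion, of the set of nonempty cyclic flats of $M$. -/

import Mathlib

open scoped TensorProduct

noncomputable section

namespace IdealOfPairs

variable {ι k : Type*} [Fintype ι] [Field k]

/-- A linear subspace `W ⊆ k^ι` is a realization of the matroid `M` on the ground set `ι` if, for
every subset `B`, the composite `W → k^ι → k^B` is an isomorphism if and only if `B` is a basis. -/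
structure IsRealization (M : Matroid ι) (W : Submodule k (ι → k)) : Prop where
  ground_eq : M.E = Set.univ
  isBase_iff : ∀ B : Set ι,
    M.IsBase B ↔ Function.Bijective (fun (w : W) (i : B) => (w : ι → k) i)

/-- `W^⊥ = (k^ι / W)^*`, regarded as a subspace of `k^ι` through the standard coordinates:
the coefficient vectors of the linear forms on `k^ι` that vanish on `W`. -/
def perp (W : Submodule k (ι → k)) : Submodule k (ι → k) where
  carrier := {y | ∀ w ∈ W, ∑ i, y i * w i = 0}
  zero_mem' := by simp
  add_mem' := by
    intro a b ha hb w hw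
    simp only [Pi.add_apply, add_mul, Finset.sum_add_distrib, ha w hw, hb w hw, add_zero]
  smul_mem' := by
    intro c a ha w hw
    simp only [Pi.smul_apply, smul_eq_mul, mul_assoc, ← Finset.mul_sum, ha w hw, mul_zero]

/-- The coordinate ring `k[U] = Sym (U^*)` of a linear subspace `U ⊆ k^ι`, a polynomial ring.
(It is the ring of polynomials on `U`, not of polynomial functions, so `k` may be finite.) -/
abbrev CoordRing (U : Submodule k (ι → k)) : Type _ :=
  SymmetricAlgebra k (Module.Dual k U)

/-- The restriction to `U` of the `i`-th coordinate function of `k^ι`, as an element of `k[U]`.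
For `U = W` this is `f_i`, for `U = W^⊥` it is `g_i`. -/
def coord (U : Submodule k (ι → k)) (i : ι) : CoordRing U :=
  SymmetricAlgebra.ι k (Module.Dual k U) ((LinearMap.proj i : (ι → k) →ₗ[k] k).comp U.subtype)

/-- The homogeneous polynomials of degree `d` on `U`. -/
def homogPart (U : Submodule k (ι → k)) (d : ℕ) : Submodule k (CoordRing U) :=
  LinearMap.range (SymmetricAlgebra.ι k (Module.Dual k U)) ^ d

/-- The bigraded ring `S = R ⊗ R^⊥`, where `R = k[W]` and `R^⊥ = k[W^⊥]`. It is an `R`-algebra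
through the left factor. -/
abbrev BigradedRing (W : Submodule k (ι → k)) : Type _ :=
  CoordRing W ⊗[k] CoordRing (perp W)

/-- The ideal of pairs `𝔞 = (f_i g_i : i ∈ ι)` of `S`. -/
def idealOfPairs (W : Submodule k (ι → k)) : Ideal (BigradedRing W) :=
  Ideal.span (Set.range fun i => coord W i ⊗ₜ[k] coord (perp W) i)

/-- The slice `S_(·,d) = R ⊗ (R^⊥)_d` of `S`, an `R`-submodule of `S`. -/
def slice (W : Submodule k (ι → k)) (d : ℕ) : Submodule (CoordRing W) (BigradedRing W) :=
  (homogPart (perp W) d).baseChange (CoordRing W)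

/-- The slice `(S/𝔞)_(·,d)` of the bigraded ring `S/𝔞`, that is, the image of `S_(·,d)` in `S/𝔞`,
an `R`-submodule of `S/𝔞`. -/
def quotSlice (W : Submodule k (ι → k)) (d : ℕ) :
    Submodule (CoordRing W) (BigradedRing W ⧸ idealOfPairs W) :=
  (slice W d).map (Ideal.Quotient.mkₐ (CoordRing W) (idealOfPairs W)).toLinearMap

/-- The ideal `P_F = (f_i : i ∈ F)` of `R`. -/
def flatIdeal (W : Submodule k (ι → k)) (F : Set ι) : Ideal (CoordRing W) :=
  Ideal.span (coord W '' F)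

/-- A flat is cyclic if it is a (possibly empty) union of circuits. -/
def IsCyclicFlat {α : Type*} (M : Matroid α) (F : Set α) : Prop :=
  M.IsFlat F ∧ ∃ 𝒞 : Set (Set α), (∀ C ∈ 𝒞, M.IsCircuit C) ∧ F = ⋃₀ 𝒞

/-- The minimal primes of a module: the primes that are minimal over its annihilator. For a
finitely generated module these are the minimal elements of its support. -/
def moduleMinimalPrimes (R N : Type*) [CommRing R] [AddCommGroup N] [Module R N] :
    Set (Ideal R) :=
  (Module.annihilator R N).minimalPrimes

end IdealOfPairs

end

/-!
The slice `(S/𝔞)_(·,1)` is the cokernel of the pairs `f_i ⊗ g_i` in `R ⊗ (W^⊥)^*`, because the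
degree-one part of an ideal of `R ⊗ Sym V` generated by such pairs is spanned by them over `R`.
Localize it at a prime `P` of `R` and let `F = {i | f_i ∈ P}`, which is a flat. The `f_i` with
`i ∉ F` become units, so the corresponding relations become `1 ⊗ g_i`.

* Support: if the `g_i` with `i ∉ F` span `(W^⊥)^*`, then the localization is zero; otherwise a
  linear form vanishing on them maps the cokernel onto `R/P`. By Gale duality the second case means
  that `F` is dependent, that is, contains a circuit, equivalently the closure of a circuit, which
  is a nonempty cyclic flat.
* Associated primes: the coefficients of the relations now lie in the symmetric algebra of the span
  `H` of the `f_i` with `i ∈ F`. Writing `R = Sym K ⊗ Sym H` for a complement `K` of `H`, the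
  cokernel is `Sym K ⊗ Q`, which is torsion-free over `Sym K`. So an associated prime `P` meets
  `Sym K` in zero, which forces `P = P_F`.
-/

noncomputable section

namespace IdealOfPairs

open Submodule

section PairModule

variable (k : Type*) {R V ι : Type*} [CommRing k] [CommRing R] [Algebra k R]
  [AddCommGroup V] [Module k V]

/-- The submodule of `R ⊗ V` generated by the pairs `a i ⊗ v i`. -/
def pairRelations (a : ι → R) (v : ι → V) : Submodule R (R ⊗[k] V) :=
  span R (Set.range fun i => a i ⊗ₜ v i)

/-- The cokernel of the map `R^ι → R ⊗ V` given by the pairs `a i ⊗ v i`. For `a i = f_i` and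
`v i = g_i` in `V = (W^⊥)^*` this is the slice `(S/𝔞)_(·,1)`. -/
abbrev PairModule (a : ι → R) (v : ι → V) : Type _ :=
  (R ⊗[k] V) ⧸ pairRelations k a v

variable {k}

theorem tmul_mem_pairRelations (a : ι → R) (v : ι → V) (i : ι) :
    a i ⊗ₜ v i ∈ pairRelations k a v :=
  subset_span ⟨i, rfl⟩

theorem mem_annihilator_pairModule {a : ι → R} {v : ι → V} {r : R} :
    r ∈ Module.annihilator R (PairModule k a v) ↔ ∀ x, r • x ∈ pairRelations k a v := by
  simp only [annihilator_quotient, mem_colon, Set.mem_univ, true_imp_iff]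

/-- Every kernel in `R ⊗ V` is the degree-one part of an ideal of `R ⊗ Sym V`: let the symmetric
algebra act on the square-zero extension of `R` by the target. -/
theorem exists_ideal_baseChange_ι_mem_iff {Q : Type*} [AddCommGroup Q] [Module R Q]
    (φ : R ⊗[k] V →ₗ[R] Q) :
    ∃ J : Ideal (R ⊗[k] SymmetricAlgebra k V),
      ∀ x, (SymmetricAlgebra.ι k V).baseChange R x ∈ J ↔ φ x = 0 := by
  let _ : Module k Q := Module.compHom Q (algebraMap k R)
  have : IsScalarTower k R Q := .of_algebraMap_smul fun _ _ => rfl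
  let _ : Module Rᵐᵒᵖ Q := Module.compHom Q ((RingHom.id R).fromOpposite fun _ _ => .all _ _)
  have : IsCentralScalar R Q := ⟨fun _ _ => rfl⟩
  have : IsScalarTower k Rᵐᵒᵖ Q := ⟨fun c r q => smul_assoc c r.unop q⟩
  let g : V →ₗ[k] Q := φ.restrictScalars k ∘ₗ TensorProduct.mk k R V 1
  let Φ : R ⊗[k] SymmetricAlgebra k V →ₐ[R] TrivSqZeroExt R Q :=
    Algebra.TensorProduct.lift (Algebra.ofId _ _)
      (SymmetricAlgebra.lift ((TrivSqZeroExt.inrHom R Q).restrictScalars k ∘ₗ g))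
      fun _ _ => .all _ _
  have hΦ (x : R ⊗[k] V) :
      Φ ((SymmetricAlgebra.ι k V).baseChange R x) = TrivSqZeroExt.inr (φ x) := by
    induction x with
    | zero => simp
    | add x y hx hy => simp only [map_add, hx, hy, TrivSqZeroExt.inr_add]
    | tmul r w =>
      rw [LinearMap.baseChange_tmul, Algebra.TensorProduct.lift_tmul,
        SymmetricAlgebra.lift_ι_apply, Algebra.ofId_apply, ← Algebra.smul_def]
      simp [g, ← map_smul, TensorProduct.smul_tmul', ← TrivSqZeroExt.inr_smul]
  refine ⟨RingHom.ker Φ, fun x => ?_⟩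
  rw [RingHom.mem_ker, hΦ, ← TrivSqZeroExt.inr_zero R, TrivSqZeroExt.inr_injective.eq_iff]

theorem baseChange_ι_mem_span_iff (a : ι → R) (v : ι → V) {x : R ⊗[k] V} :
    (SymmetricAlgebra.ι k V).baseChange R x ∈
        Ideal.span (Set.range fun i => a i ⊗ₜ[k] SymmetricAlgebra.ι k V (v i)) ↔
      x ∈ pairRelations k a v := by
  constructor
  · obtain ⟨J, hJ⟩ := exists_ideal_baseChange_ι_mem_iff (pairRelations k a v).mkQ
    suffices h : Ideal.span (Set.range fun i => a i ⊗ₜ[k] SymmetricAlgebra.ι k V (v i)) ≤ J from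
      fun hx => (Quotient.mk_eq_zero _).1 ((hJ x).1 (h hx))
    rw [Ideal.span_le]
    rintro _ ⟨i, rfl⟩
    exact (hJ (a i ⊗ₜ v i)).2 ((Quotient.mk_eq_zero _).2 (tmul_mem_pairRelations a v i))
  · suffices h : pairRelations k a v ≤ ((Ideal.span (Set.range fun i =>
        a i ⊗ₜ[k] SymmetricAlgebra.ι k V (v i))).restrictScalars R).comap
          ((SymmetricAlgebra.ι k V).baseChange R) from fun hx => h hx
    rw [pairRelations, span_le]
    rintro _ ⟨i, rfl⟩
    exact Ideal.subset_span ⟨i, rfl⟩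

open Classical in
/-- The coefficients `a i` with those outside `P` replaced by `1`: after localizing at a prime `P`
they are units and can be dropped from the relations `a i ⊗ v i`. -/
def unitize (P : Ideal R) (a : ι → R) (i : ι) : R :=
  if a i ∈ P then a i else 1

theorem pairRelations_le_unitize (P : Ideal R) (a : ι → R) (v : ι → V) :
    pairRelations k a v ≤ pairRelations k (unitize P a) v := by
  rw [pairRelations, span_le]
  rintro _ ⟨i, rfl⟩
  have h := tmul_mem_pairRelations (k := k) (unitize P a) v i
  by_cases hi : a i ∈ P
  · rwa [unitize, if_pos hi] at h
  · rw [unitize, if_neg hi] at h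
    simpa [TensorProduct.smul_tmul'] using smul_mem _ (a i) h

theorem exists_notMem_smul_mem_pairRelations [Finite ι] (P : Ideal R) [hP : P.IsPrime] (a : ι → R)
    (v : ι → V) :
    ∃ u ∉ P, ∀ x ∈ pairRelations k (unitize P a) v, u • x ∈ pairRelations k a v := by
  classical
  have := Fintype.ofFinite ι
  refine ⟨∏ j with a j ∉ P, a j, by simp [hP.prod_mem_iff], fun x hx => ?_⟩
  suffices h : pairRelations k (unitize P a) v ≤
      (pairRelations k a v).comap (LinearMap.lsmul R _ (∏ j with a j ∉ P, a j)) from h hx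
  rw [pairRelations, span_le]
  rintro _ ⟨i, rfl⟩
  rw [SetLike.mem_coe, mem_comap, LinearMap.lsmul_apply]
  by_cases hi : a i ∈ P
  · simpa only [unitize, if_pos hi] using smul_mem _ _ (tmul_mem_pairRelations a v i)
  · rw [← Finset.prod_erase_mul _ _ (Finset.mem_filter.2 ⟨Finset.mem_univ i, hi⟩), mul_smul]
    simpa [unitize, if_neg hi, TensorProduct.smul_tmul'] using
      smul_mem _ _ (tmul_mem_pairRelations (k := k) a v i)

end PairModule

section Support

variable {k R V ι : Type*} [Field k] [CommRing R] [Algebra k R] [AddCommGroup V] [Module k V]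
  {a : ι → R} {v : ι → V} {P : Ideal R}

theorem pairRelations_unitize_eq_top (h : span k (v '' {i | a i ∉ P}) = ⊤) :
    pairRelations k (unitize P a) v = ⊤ := by
  rw [eq_top_iff, ← baseChange_top (R := k) (M := V) R, ← h, baseChange_span, span_le]
  rintro _ ⟨_, ⟨i, hi, rfl⟩, rfl⟩
  have h := tmul_mem_pairRelations (k := k) (unitize P a) v i
  rwa [unitize, if_neg hi] at h

theorem annihilator_pairModule_le_of_span_ne_top [P.IsPrime]
    (h : span k (v '' {i | a i ∉ P}) ≠ ⊤) : Module.annihilator R (PairModule k a v) ≤ P := by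
  obtain ⟨w, hw⟩ : ∃ w, w ∉ span k (v '' {i | a i ∉ P}) := by
    simpa [eq_top_iff'] using h
  obtain ⟨φ, hφw, hφ⟩ := exists_le_ker_of_notMem hw
  let Φ : R ⊗[k] V →ₗ[R] R := (TensorProduct.AlgebraTensorModule.rid k R R).toLinearMap ∘ₗ
    φ.baseChange R
  have hΦ (r : R) (x : V) : Φ (r ⊗ₜ x) = φ x • r := by simp [Φ]
  have relations_le : pairRelations k a v ≤ comap Φ P := by
    rw [pairRelations, span_le]
    rintro _ ⟨i, rfl⟩
    rw [SetLike.mem_coe, mem_comap, hΦ]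
    by_cases hi : a i ∈ P
    · exact smul_of_tower_mem P _ hi
    · rw [hφ (subset_span ⟨i, hi, rfl⟩), zero_smul]
      exact P.zero_mem
  intro r hr
  have h := relations_le (mem_annihilator_pairModule.1 hr (1 ⊗ₜ w))
  rw [mem_comap, TensorProduct.smul_tmul', hΦ, smul_eq_mul, mul_one] at h
  simpa [smul_smul, hφw] using smul_of_tower_mem P (φ w)⁻¹ h

theorem annihilator_pairModule_le_iff [Finite ι] [P.IsPrime] :
    Module.annihilator R (PairModule k a v) ≤ P ↔ span k (v '' {i | a i ∉ P}) ≠ ⊤ := by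
  refine ⟨fun hle htop => ?_, annihilator_pairModule_le_of_span_ne_top⟩
  obtain ⟨u, huP, hu⟩ := exists_notMem_smul_mem_pairRelations (k := k) P a v
  rw [pairRelations_unitize_eq_top htop] at hu
  exact huP (hle (mem_annihilator_pairModule.2 fun x => hu x mem_top))

end Support

section Polynomial

variable {k C A R V ι : Type*} [CommRing k] [CommRing C] [Algebra k C] [CommRing A] [Algebra k A]
  [CommRing R] [Algebra k R] [AddCommGroup V] [Module k V]

/-- The isomorphism `C ⊗ (A ⊗ V) ≃ R ⊗ V` induced by a decomposition `C ⊗ A ≃ R` of the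
coefficient ring. -/
def splitCoeff (e : C ⊗[k] A ≃ₐ[k] R) (V : Type*) [AddCommGroup V] [Module k V] :
    C ⊗[k] (A ⊗[k] V) ≃ₗ[k] R ⊗[k] V :=
  (TensorProduct.assoc k C A V).symm ≪≫ₗ e.toLinearEquiv.rTensor V

variable (e : C ⊗[k] A ≃ₐ[k] R) {a : ι → A} {v : ι → V}

theorem splitCoeff_tmul (c : C) (b : A) (w : V) :
    splitCoeff e V (c ⊗ₜ (b ⊗ₜ w)) = e (c ⊗ₜ b) ⊗ₜ w := by
  simp [splitCoeff]

theorem splitCoeff_tmul_smul (c c' : C) (b : A) (y : A ⊗[k] V) :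
    splitCoeff e V ((c * c') ⊗ₜ (b • y)) = e (c ⊗ₜ b) • splitCoeff e V (c' ⊗ₜ y) := by
  induction y with
  | zero => simp
  | add x y hx hy => simp only [smul_add, TensorProduct.tmul_add, map_add, hx, hy]
  | tmul b' w =>
    simp only [TensorProduct.smul_tmul', splitCoeff_tmul, smul_eq_mul, ← map_mul,
      Algebra.TensorProduct.tmul_mul_tmul]

theorem splitCoeff_smul (c : C) (z : C ⊗[k] (A ⊗[k] V)) :
    splitCoeff e V (c • z) = e (c ⊗ₜ 1) • splitCoeff e V z := by
  induction z with
  | zero => simp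
  | add x y hx hy => simp only [smul_add, map_add, hx, hy]
  | tmul c' y =>
    rw [← splitCoeff_tmul_smul, one_smul, TensorProduct.smul_tmul', smul_eq_mul]

theorem splitCoeff_tmul_mem_pairRelations (c : C) {y : A ⊗[k] V} (hy : y ∈ pairRelations k a v) :
    splitCoeff e V (c ⊗ₜ y) ∈ pairRelations k (fun i => e (1 ⊗ₜ a i)) v := by
  induction hy using closure_induction with
  | zero => simp
  | add x y _ _ hx hy => simpa only [TensorProduct.tmul_add, map_add] using add_mem hx hy
  | smul_mem b y hy =>
    obtain ⟨i, rfl⟩ := hy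
    rw [← mul_one c, splitCoeff_tmul_smul, splitCoeff_tmul]
    exact smul_mem _ _ (tmul_mem_pairRelations _ v i)

theorem lTensor_mkQ_splitCoeff_symm {x : R ⊗[k] V}
    (hx : x ∈ pairRelations k (fun i => e (1 ⊗ₜ a i)) v) :
    ((pairRelations k a v).mkQ.restrictScalars k).lTensor C ((splitCoeff e V).symm x) = 0 := by
  induction hx using closure_induction with
  | zero => simp
  | add x y _ _ hx hy => rw [map_add, map_add, hx, hy, add_zero]
  | smul_mem r x hx =>
    obtain ⟨i, rfl⟩ := hx
    obtain ⟨t, rfl⟩ := e.surjective r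
    induction t with
    | zero => simp
    | add t t' ht ht' => rw [map_add, add_smul, map_add, map_add, ht, ht', add_zero]
    | tmul c b =>
      have h : splitCoeff e V (c ⊗ₜ (b • (a i ⊗ₜ v i))) =
          e (c ⊗ₜ b) • (e (1 ⊗ₜ a i) ⊗ₜ v i) := by
        rw [← splitCoeff_tmul, ← splitCoeff_tmul_smul, mul_one]
      rw [← h, LinearEquiv.symm_apply_apply, LinearMap.lTensor_tmul,
        LinearMap.restrictScalars_apply, mkQ_apply,
        (Quotient.mk_eq_zero _).2 (smul_mem _ b (tmul_mem_pairRelations a v i)),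
        TensorProduct.tmul_zero]

theorem splitCoeff_mem_pairRelations_iff (z : C ⊗[k] (A ⊗[k] V)) :
    splitCoeff e V z ∈ pairRelations k (fun i => e (1 ⊗ₜ a i)) v ↔
      ((pairRelations k a v).mkQ.restrictScalars k).lTensor C z = 0 := by
  refine ⟨fun hz => by simpa using lTensor_mkQ_splitCoeff_symm e hz, fun hz => ?_⟩
  obtain ⟨z, rfl⟩ : z ∈ LinearMap.range
      (((pairRelations k a v).restrictScalars k).subtype.lTensor C) :=
    (lTensor_mkQ C ((pairRelations k a v).restrictScalars k)).le hz
  clear hz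
  induction z with
  | zero => simp
  | add x y hx hy => simpa only [map_add] using add_mem hx hy
  | tmul c y => exact splitCoeff_tmul_mem_pairRelations e c y.2

/-- Over `C ⊗ A` the cokernel of pairs with coefficients in `A` is `C ⊗ Q` with `Q` free over `k`,
so that it is torsion-free over `C`. -/
theorem mem_pairRelations_of_smul_mem [IsDomain C] [Module.Free k (PairModule k a v)] {c : C}
    (hc : c ≠ 0) {x : R ⊗[k] V}
    (hx : e (c ⊗ₜ 1) • x ∈ pairRelations k (fun i => e (1 ⊗ₜ a i)) v) :
    x ∈ pairRelations k (fun i => e (1 ⊗ₜ a i)) v := by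
  obtain ⟨z, rfl⟩ := (splitCoeff e V).surjective x
  rw [← splitCoeff_smul, splitCoeff_mem_pairRelations_iff] at hx
  rw [splitCoeff_mem_pairRelations_iff]
  have : c • ((pairRelations k a v).mkQ.restrictScalars k).lTensor C z = 0 := by
    rw [← hx]
    exact (LinearMap.map_smul
      (((pairRelations k a v).mkQ.restrictScalars k).baseChange C) c z).symm
  exact (smul_eq_zero.1 this).resolve_left hc

end Polynomial

section LinearForms

variable {k U U₁ U₂ : Type*} [CommRing k] [AddCommGroup U] [Module k U] [AddCommGroup U₁]
  [Module k U₁] [AddCommGroup U₂] [Module k U₂]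

/-- The functoriality of the symmetric algebra. -/
def symMap (f : U₁ →ₗ[k] U₂) : SymmetricAlgebra k U₁ →ₐ[k] SymmetricAlgebra k U₂ :=
  SymmetricAlgebra.lift (SymmetricAlgebra.ι k U₂ ∘ₗ f)

theorem symMap_ι (f : U₁ →ₗ[k] U₂) (u : U₁) :
    symMap f (SymmetricAlgebra.ι k U₁ u) = SymmetricAlgebra.ι k U₂ (f u) :=
  SymmetricAlgebra.lift_ι_apply _ u

variable (k) in
/-- The ideal of `Sym U` generated by a set of linear forms. -/
def linearIdeal (S : Set U) : Ideal (SymmetricAlgebra k U) :=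
  Ideal.span (SymmetricAlgebra.ι k U '' S)

theorem linearIdeal_le_iff {S : Set U} {P : Ideal (SymmetricAlgebra k U)} :
    linearIdeal k S ≤ P ↔ ∀ u ∈ S, SymmetricAlgebra.ι k U u ∈ P := by
  rw [linearIdeal, Ideal.span_le, Set.image_subset_iff]
  rfl

theorem ι_mem_of_mem_span {S : Set U} {P : Ideal (SymmetricAlgebra k U)}
    (hP : ∀ u ∈ S, SymmetricAlgebra.ι k U u ∈ P) {u : U} (hu : u ∈ span k S) :
    SymmetricAlgebra.ι k U u ∈ P := by
  have h : span k S ≤ (P.restrictScalars k).comap (SymmetricAlgebra.ι k U) := span_le.2 hP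
  exact h hu

theorem linearIdeal_span (S : Set U) : linearIdeal k (span k S : Set U) = linearIdeal k S :=
  le_antisymm (linearIdeal_le_iff.2 fun _ => ι_mem_of_mem_span (linearIdeal_le_iff.1 le_rfl))
    (Ideal.span_mono (Set.image_mono subset_span))

variable {K H : Submodule k U} (hKH : IsCompl K H)

theorem sub_symMap_projection_mem (r : SymmetricAlgebra k U) :
    r - symMap K.subtype (symMap (K.projectionOnto H hKH) r) ∈ linearIdeal k (H : Set U) := by
  let q := Ideal.Quotient.mkₐ k (linearIdeal k (H : Set U))
  have hq : (q.comp (symMap K.subtype)).comp (symMap (K.projectionOnto H hKH)) = q := by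
    refine SymmetricAlgebra.algHom_ext (LinearMap.ext fun u => ?_)
    have h : SymmetricAlgebra.ι k U (u - K.projection H hKH u) ∈ linearIdeal k (H : Set U) :=
      Ideal.subset_span ⟨_, sub_projection_mem hKH u, rfl⟩
    rw [map_sub] at h
    simpa [symMap_ι, q] using (Ideal.Quotient.eq.2 h).symm
  exact Ideal.Quotient.eq.1 (DFunLike.congr_fun hq r).symm

theorem linearIdeal_eq_ker :
    linearIdeal k (H : Set U) = RingHom.ker (symMap (K.projectionOnto H hKH)) := by
  refine le_antisymm (linearIdeal_le_iff.2 fun u hu => ?_) fun r hr => ?_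
  · rw [RingHom.mem_ker, symMap_ι, (projectionOnto_apply_eq_zero_iff hKH).2 hu, map_zero]
  · simpa [RingHom.mem_ker.1 hr] using sub_symMap_projection_mem hKH r

/-- `Sym (K ⊕ H) = Sym K ⊗ Sym H`. -/
def symEquivOfIsCompl :
    SymmetricAlgebra k K ⊗[k] SymmetricAlgebra k H ≃ₐ[k] SymmetricAlgebra k U :=
  AlgEquiv.ofAlgHom
    (Algebra.TensorProduct.lift (symMap K.subtype) (symMap H.subtype) fun _ _ => .all _ _)
    (SymmetricAlgebra.lift
      (Algebra.TensorProduct.includeLeft.toLinearMap ∘ₗ SymmetricAlgebra.ι k K ∘ₗ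
          K.projectionOnto H hKH +
        Algebra.TensorProduct.includeRight.toLinearMap ∘ₗ SymmetricAlgebra.ι k H ∘ₗ
          H.projectionOnto K hKH.symm))
    (SymmetricAlgebra.algHom_ext (LinearMap.ext fun u => by
      have h := congrArg (SymmetricAlgebra.ι k U) (projection_add_projection_eq_self hKH u)
      rw [map_add] at h
      simpa [symMap_ι] using h))
    (Algebra.TensorProduct.ext (SymmetricAlgebra.algHom_ext (LinearMap.ext fun u => by
        simp [symMap_ι]))
      (SymmetricAlgebra.algHom_ext (LinearMap.ext fun u => by simp [symMap_ι])))

theorem symEquivOfIsCompl_tmul_one (c : SymmetricAlgebra k K) :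
    symEquivOfIsCompl hKH (c ⊗ₜ 1) = symMap K.subtype c := by
  simp [symEquivOfIsCompl]

theorem symEquivOfIsCompl_one_tmul (c : SymmetricAlgebra k H) :
    symEquivOfIsCompl hKH (1 ⊗ₜ c) = symMap H.subtype c := by
  simp [symEquivOfIsCompl]

end LinearForms

section AssociatedPrimes

variable {k U V ι : Type*} [Field k] [AddCommGroup U] [Module k U] [AddCommGroup V] [Module k V]

theorem ι_mem_linearIdeal_iff {S : Set U} {u : U} :
    SymmetricAlgebra.ι k U u ∈ linearIdeal k S ↔ u ∈ span k S := by
  refine ⟨fun hu => ?_, ι_mem_of_mem_span (linearIdeal_le_iff.1 le_rfl)⟩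
  by_contra hS
  obtain ⟨φ, hφu, hφ⟩ := exists_le_ker_of_notMem hS
  have linearIdeal_le : linearIdeal k S ≤ RingHom.ker (SymmetricAlgebra.lift φ) :=
    linearIdeal_le_iff.2 fun s hs => by
      rw [RingHom.mem_ker, SymmetricAlgebra.lift_ι_apply]
      exact hφ (subset_span hs)
  have h := linearIdeal_le hu
  rw [RingHom.mem_ker, SymmetricAlgebra.lift_ι_apply] at h
  exact hφu h

theorem isPrime_linearIdeal (S : Set U) : (linearIdeal k S).IsPrime := by
  obtain ⟨K, hK⟩ := Submodule.exists_isCompl (span k S)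
  rw [← linearIdeal_span, linearIdeal_eq_ker hK.symm]
  exact RingHom.ker_isPrime _

variable {P : Ideal (SymmetricAlgebra k U)} {u : ι → U} {v : ι → V}

/-- After the forms outside `P` have been made units, only the forms in `H` occur as coefficients,
and `Sym U` is `Sym K ⊗ Sym H`. -/
theorem mem_pairRelations_unitize_of_smul_mem {K H : Submodule k U} (hKH : IsCompl K H)
    (hu : ∀ i, SymmetricAlgebra.ι k U (u i) ∈ P → u i ∈ H) {c : SymmetricAlgebra k K} (hc : c ≠ 0)
    {x : SymmetricAlgebra k U ⊗[k] V}
    (hx : symMap K.subtype c • x ∈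
      pairRelations k (unitize P fun i => SymmetricAlgebra.ι k U (u i)) v) :
    x ∈ pairRelations k (unitize P fun i => SymmetricAlgebra.ι k U (u i)) v := by
  have exists_preimage (i : ι) : ∃ b : SymmetricAlgebra k H,
      symEquivOfIsCompl hKH (1 ⊗ₜ b) = unitize P (fun i => SymmetricAlgebra.ι k U (u i)) i := by
    simp_rw [symEquivOfIsCompl_one_tmul, unitize]
    split_ifs with hi
    · exact ⟨SymmetricAlgebra.ι k H ⟨u i, hu i hi⟩, symMap_ι _ _⟩
    · exact ⟨1, map_one _⟩
  choose b hb using exists_preimage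
  rw [← symEquivOfIsCompl_tmul_one hKH] at hx
  rw [← funext hb] at hx ⊢
  exact mem_pairRelations_of_smul_mem _ hc hx

theorem eq_linearIdeal_of_mem_associatedPrimes [Finite ι]
    (hP : P ∈ associatedPrimes (SymmetricAlgebra k U)
      (PairModule k (fun i => SymmetricAlgebra.ι k U (u i)) v)) :
    P = linearIdeal k (u '' {i | SymmetricAlgebra.ι k U (u i) ∈ P}) := by
  obtain ⟨hprime, m, hm⟩ := hP
  obtain ⟨x, rfl⟩ := mkQ_surjective _ m
  have mem_iff (r : SymmetricAlgebra k U) : r ∈ P ↔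
      ∃ n, r ^ n • x ∈ pairRelations k (fun i => SymmetricAlgebra.ι k U (u i)) v := by
    conv_lhs => rw [hm]
    simp only [Ideal.mem_radical_iff, mem_colon_singleton, mem_bot, mkQ_apply, ← Quotient.mk_smul,
      Quotient.mk_eq_zero]
  set S := u '' {i | SymmetricAlgebra.ι k U (u i) ∈ P}
  have linearIdeal_le : linearIdeal k S ≤ P := by
    rw [linearIdeal_le_iff]
    rintro _ ⟨i, hi, rfl⟩
    exact hi
  refine le_antisymm (fun r hr => ?_) linearIdeal_le
  obtain ⟨K, hK⟩ := Submodule.exists_isCompl (span k S)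
  have hsub := sub_symMap_projection_mem hK.symm r
  rw [linearIdeal_span] at hsub
  set c := symMap (K.projectionOnto _ hK.symm) r
  suffices h : c = 0 by simpa [h] using hsub
  by_contra hc0
  obtain ⟨n, hn⟩ := (mem_iff (symMap K.subtype c)).1
    ((sub_mem_iff_right P hr).1 (linearIdeal_le hsub))
  rw [← map_pow] at hn
  obtain ⟨w, hwP, hw⟩ :=
    exists_notMem_smul_mem_pairRelations (k := k) P (fun i => SymmetricAlgebra.ι k U (u i)) v
  have hx := mem_pairRelations_unitize_of_smul_mem hK.symm
    (fun i hi => subset_span (Set.mem_image_of_mem u hi)) (pow_ne_zero n hc0)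
    (pairRelations_le_unitize _ _ _ hn)
  exact hwP ((mem_iff w).2 ⟨1, by simpa using hw x hx⟩)

end AssociatedPrimes

section Dual

variable {k U β : Type*} [Field k] [AddCommGroup U] [Module k U] [FiniteDimensional k U]

theorem span_dual_eq_top_iff {S : Set (Module.Dual k U)} :
    span k S = ⊤ ↔ ∀ u, (∀ φ ∈ S, φ u = 0) → u = 0 := by
  have h (u : U) : u ∈ (span k S).dualCoannihilator ↔ ∀ φ ∈ S, φ u = 0 := by
    rw [← SetLike.mem_coe, coe_dualCoannihilator_span, Set.mem_ofPred_eq]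
  simp_rw [← h, ← Submodule.eq_bot_iff]
  refine ⟨fun htop => by rw [htop, dualCoannihilator_top], fun hbot => ?_⟩
  rw [← Subspace.dualCoannihilator_dualAnnihilator_eq (W := span k S), hbot, dualAnnihilator_bot]

theorem injective_iff_span_range_eq_top (φ : β → Module.Dual k U) :
    Function.Injective (LinearMap.pi φ) ↔ span k (Set.range φ) = ⊤ := by
  rw [span_dual_eq_top_iff, injective_iff_map_eq_zero]
  simp [funext_iff]

theorem bijective_iff_linearIndependent_and_span_eq_top [Finite β] (φ : β → Module.Dual k U) :
    Function.Bijective (LinearMap.pi φ) ↔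
      LinearIndependent k φ ∧ span k (Set.range φ) = ⊤ := by
  have := Fintype.ofFinite β
  rw [Function.Bijective, injective_iff_span_range_eq_top, and_comm, and_congr_left_iff]
  intro hspan
  have hinj := (injective_iff_span_range_eq_top φ).2 hspan
  constructor
  · intro hsurj
    refine linearIndependent_of_top_le_span_of_card_eq_finrank hspan.ge ?_
    rw [Subspace.dual_finrank_eq,
      (LinearEquiv.ofBijective (LinearMap.pi φ) ⟨hinj, hsurj⟩).finrank_eq, Module.finrank_pi]
  · intro hindep
    refine (LinearMap.injective_iff_surjective_of_finrank_eq_finrank ?_).1 hinj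
    rw [← Subspace.dual_finrank_eq, Module.finrank_eq_card_basis (.mk hindep hspan.ge),
      Module.finrank_pi]

end Dual

section Realization

variable {ι k : Type*} [Field k]

/-- The restriction to `U` of the `i`-th coordinate function of `k^ι`, as a linear form; its image
in `k[U]` is `coord U i`. -/
def form (U : Submodule k (ι → k)) (i : ι) : Module.Dual k U :=
  (LinearMap.proj i : (ι → k) →ₗ[k] k).comp U.subtype

theorem form_apply (U : Submodule k (ι → k)) (i : ι) (u : U) : form U i u = (u : ι → k) i := rfl

theorem flatIdeal_eq_linearIdeal (U : Submodule k (ι → k)) (F : Set ι) :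
    flatIdeal U F = linearIdeal k (form U '' F) := by
  rw [linearIdeal, Set.image_image]
  rfl

theorem isPrime_flatIdeal (W : Submodule k (ι → k)) (F : Set ι) : (flatIdeal W F).IsPrime := by
  rw [flatIdeal_eq_linearIdeal]
  exact isPrime_linearIdeal _

theorem flatIdeal_le_iff {W : Submodule k (ι → k)} {P : Ideal (CoordRing W)} {F : Set ι} :
    flatIdeal W F ≤ P ↔ F ⊆ {i | coord W i ∈ P} := by
  rw [flatIdeal, Ideal.span_le, Set.image_subset_iff]
  rfl

theorem span_range_form [Finite ι] (U : Submodule k (ι → k)) :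
    span k (Set.range (form U)) = ⊤ := by
  rw [← injective_iff_span_range_eq_top]
  exact Subtype.val_injective

/-- Gale duality: the matroids of `W` and `W^⊥` are dual to each other. -/
theorem span_form_perp_compl_eq_top_iff [Fintype ι] {W : Submodule k (ι → k)} {F : Set ι} :
    span k (form (perp W) '' Fᶜ) = ⊤ ↔ LinearIndepOn k (form W) F := by
  have mem_perp_iff (y : ι → k) : y ∈ perp W ↔ ∑ i, y i • form W i = 0 := by
    simp [perp, LinearMap.ext_iff, form_apply]
  rw [span_dual_eq_top_iff, linearIndepOn_iff, Finsupp.equivFunOnFinite.forall_congr_left]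
  simp only [Subtype.forall, mem_perp_iff, Finsupp.mem_supported', Finsupp.linearCombination_apply]
  refine forall_congr' fun y => ?_
  have eq_zero_iff : Finsupp.equivFunOnFinite.symm y = 0 ↔ y = 0 := Equiv.symm_apply_eq _
  simp only [Set.forall_mem_image, Finsupp.sum_fintype, zero_smul, implies_true, form_apply,
    mk_eq_zero, Finsupp.equivFunOnFinite_symm_apply_apply, eq_zero_iff]
  exact forall_comm

namespace IsRealization

variable [Finite ι] {M : Matroid ι} {W : Submodule k (ι → k)}

theorem isBase_iff_linearIndepOn (hW : IsRealization M W) {B : Set ι} :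
    M.IsBase B ↔ LinearIndepOn k (form W) B ∧ span k (form W '' B) = ⊤ := by
  rw [hW.isBase_iff, Set.image_eq_range]
  exact bijective_iff_linearIndependent_and_span_eq_top fun i : B => form W i

theorem indep_iff (hW : IsRealization M W) {I : Set ι} :
    M.Indep I ↔ LinearIndepOn k (form W) I := by
  constructor
  · intro hI
    obtain ⟨B, hB, hIB⟩ := hI.exists_isBase_superset
    exact (hW.isBase_iff_linearIndepOn.1 hB).1.mono hIB
  · intro hI
    obtain ⟨B, -, hIB, hspan, hB⟩ := exists_linearIndepOn_extension hI (Set.subset_univ I)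
    refine (hW.isBase_iff_linearIndepOn.2 ⟨hB, top_unique ?_⟩).indep.subset hIB
    rwa [← span_range_form, span_le, ← Set.image_univ]

theorem mem_closure_iff_of_indep (hW : IsRealization M W) {I : Set ι} (hI : M.Indep I) {j : ι} :
    j ∈ M.closure I ↔ form W j ∈ span k (form W '' I) := by
  rw [hI.mem_closure_iff', hW.indep_iff, hW.ground_eq, (hW.indep_iff.1 hI).mem_span_iff]
  simp

theorem mem_closure_iff (hW : IsRealization M W) {F : Set ι} {j : ι} :
    j ∈ M.closure F ↔ form W j ∈ span k (form W '' F) := by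
  obtain ⟨I, hI⟩ := M.exists_isBasis F (by simp [hW.ground_eq])
  suffices h : span k (form W '' I) = span k (form W '' F) by
    rw [← hI.closure_eq_closure, hW.mem_closure_iff_of_indep hI.indep, h]
  refine le_antisymm (span_mono (Set.image_mono hI.subset)) (span_le.2 ?_)
  rintro _ ⟨i, hi, rfl⟩
  exact (hW.mem_closure_iff_of_indep hI.indep).1 (hI.subset_closure hi)

theorem isFlat_setOf_coord_mem (hW : IsRealization M W) (P : Ideal (CoordRing W)) :
    M.IsFlat {i | coord W i ∈ P} := by
  rw [Matroid.isFlat_iff_closure_eq]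
  refine (M.subset_closure _ (by simp [hW.ground_eq])).antisymm' fun j hj => ?_
  exact ι_mem_of_mem_span (Set.forall_mem_image.2 fun i hi => hi) (hW.mem_closure_iff.1 hj)

theorem setOf_coord_mem_flatIdeal (hW : IsRealization M W) {F : Set ι} (hF : M.IsFlat F) :
    {i | coord W i ∈ flatIdeal W F} = F := by
  ext j
  rw [Set.mem_ofPred_eq, flatIdeal_eq_linearIdeal, coord, ι_mem_linearIdeal_iff]
  exact hW.mem_closure_iff.symm.trans (by rw [hF.closure])

end IsRealization

end Realization

section CyclicFlats

variable {α : Type*} {M : Matroid α}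

theorem isCyclicFlat_closure {C : Set α} (hC : M.IsCircuit C) :
    IsCyclicFlat M (M.closure C) := by
  have subset_closure := M.subset_closure C hC.subset_ground
  refine ⟨M.isFlat_closure C, {D | M.IsCircuit D ∧ D ⊆ M.closure C}, fun D hD => hD.1,
    subset_antisymm (fun x hx => ?_) (Set.sUnion_subset fun D hD => hD.2)⟩
  by_cases hxC : x ∈ C
  · exact ⟨C, ⟨hC, subset_closure⟩, hxC⟩
  · obtain ⟨D, hDC, hD, hxD⟩ := Matroid.exists_isCircuit_of_mem_closure hx hxC
    exact ⟨D, ⟨hD, hDC.trans (Set.insert_subset hx subset_closure)⟩, hxD⟩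

theorem IsCyclicFlat.dep {F : Set α} (hF : IsCyclicFlat M F) (hne : F.Nonempty) : M.Dep F := by
  obtain ⟨hflat, 𝒞, h𝒞, rfl⟩ := hF
  obtain ⟨x, C, hC, -⟩ := hne
  exact (h𝒞 C hC).dep.superset (Set.subset_sUnion_of_mem hC) hflat.subset_ground

end CyclicFlats

section Conclusion

variable {ι k : Type*} [Fintype ι] [Field k]

theorem range_baseChange {A U V : Type*} [CommRing A] [Algebra k A] [AddCommGroup U] [Module k U]
    [AddCommGroup V] [Module k V] (f : U →ₗ[k] V) :
    LinearMap.range (f.baseChange A) = (LinearMap.range f).baseChange A := by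
  have surjective : Function.Surjective (f.rangeRestrict.baseChange A) :=
    LinearMap.lTensor_surjective A f.surjective_rangeRestrict
  rw [Submodule.baseChange, ← LinearMap.range_comp_of_range_eq_top _
    (LinearMap.range_eq_top.2 surjective), ← LinearMap.baseChange_comp, f.subtype_comp_codRestrict]

/-- The composite `R ⊗ (W^⊥)^* → R ⊗ R^⊥ = S → S/𝔞`, whose image is the slice `(S/𝔞)_(·,1)`. -/
def toQuot (W : Submodule k (ι → k)) : CoordRing W ⊗[k] Module.Dual k (perp W) →ₗ[CoordRing W]
    BigradedRing W ⧸ idealOfPairs W :=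
  (Ideal.Quotient.mkₐ (CoordRing W) (idealOfPairs W)).toLinearMap ∘ₗ
    (SymmetricAlgebra.ι k (Module.Dual k (perp W))).baseChange (CoordRing W)

theorem range_toQuot (W : Submodule k (ι → k)) : LinearMap.range (toQuot W) = quotSlice W 1 := by
  rw [toQuot, LinearMap.range_comp, range_baseChange, quotSlice, slice, homogPart, pow_one]

theorem ker_toQuot (W : Submodule k (ι → k)) :
    LinearMap.ker (toQuot W) = pairRelations k (coord W) (form (perp W)) := by
  ext x
  rw [← baseChange_ι_mem_span_iff, ← Ideal.Quotient.eq_zero_iff_mem]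
  rfl

/-- The slice `(S/𝔞)_(·,1)` is the cokernel of the pairs `f_i ⊗ g_i` in `R ⊗ (W^⊥)^*`. -/
def pairModuleEquiv (W : Submodule k (ι → k)) :
    PairModule k (coord W) (form (perp W)) ≃ₗ[CoordRing W] quotSlice W 1 :=
  quotEquivOfEq _ _ (ker_toQuot W).symm ≪≫ₗ (toQuot W).quotKerEquivRange ≪≫ₗ
    .ofEq _ _ (range_toQuot W)

theorem eq_flatIdeal_of_mem_associatedPrimes {W : Submodule k (ι → k)} {P : Ideal (CoordRing W)}
    (hP : P ∈ associatedPrimes (CoordRing W) (quotSlice W 1)) :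
    P = flatIdeal W {i | coord W i ∈ P} := by
  rw [← LinearEquiv.AssociatedPrimes.eq (pairModuleEquiv W)] at hP
  rw [flatIdeal_eq_linearIdeal]
  exact eq_linearIdeal_of_mem_associatedPrimes hP

namespace IsRealization

variable {M : Matroid ι} {W : Submodule k (ι → k)}

theorem annihilator_quotSlice_le_iff (hW : IsRealization M W) {P : Ideal (CoordRing W)}
    [P.IsPrime] :
    Module.annihilator (CoordRing W) (quotSlice W 1) ≤ P ↔ M.Dep {i | coord W i ∈ P} := by
  rw [← (pairModuleEquiv W).annihilator_eq, annihilator_pairModule_le_iff,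
    ← Matroid.not_indep_iff (by simp [hW.ground_eq]), hW.indep_iff,
    ← span_form_perp_compl_eq_top_iff]
  rfl

theorem associatedPrimes_quotSlice_subset (hW : IsRealization M W) :
    associatedPrimes (CoordRing W) (quotSlice W 1) ⊆
      {P | ∃ F : Set ι, F.Nonempty ∧ M.IsFlat F ∧ P = flatIdeal W F} := by
  intro P hP
  have : P.IsPrime := hP.isPrime
  have hann : Module.annihilator (CoordRing W) (quotSlice W 1) ≤ P :=
    annihilator_top.ge.trans (IsAssociatedPrime.annihilator_le hP)
  exact ⟨_, (hW.annihilator_quotSlice_le_iff.1 hann).nonempty, hW.isFlat_setOf_coord_mem P,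
    eq_flatIdeal_of_mem_associatedPrimes hP⟩

theorem annihilator_quotSlice_le_flatIdeal (hW : IsRealization M W) {F : Set ι}
    (hF : IsCyclicFlat M F) (hne : F.Nonempty) :
    Module.annihilator (CoordRing W) (quotSlice W 1) ≤ flatIdeal W F := by
  have := isPrime_flatIdeal W F
  rw [hW.annihilator_quotSlice_le_iff, hW.setOf_coord_mem_flatIdeal hF.1]
  exact hF.dep hne

theorem exists_isCyclicFlat_subset (hW : IsRealization M W) {P : Ideal (CoordRing W)} [P.IsPrime]
    (hP : Module.annihilator (CoordRing W) (quotSlice W 1) ≤ P) :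
    ∃ F ⊆ {i | coord W i ∈ P}, IsCyclicFlat M F ∧ F.Nonempty := by
  obtain ⟨C, hCP, hC⟩ := (hW.annihilator_quotSlice_le_iff.1 hP).exists_isCircuit_subset
  have closure_subset : M.closure C ⊆ {i | coord W i ∈ P} :=
    (hW.isFlat_setOf_coord_mem P).closure ▸ M.closure_subset_closure hCP
  exact ⟨M.closure C, closure_subset, isCyclicFlat_closure hC,
    hC.nonempty.mono (M.subset_closure C hC.subset_ground)⟩

theorem moduleMinimalPrimes_quotSlice (hW : IsRealization M W) :
    moduleMinimalPrimes (CoordRing W) (quotSlice W 1) =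
      {P | ∃ F : Set ι, Minimal (fun G => IsCyclicFlat M G ∧ G.Nonempty) F ∧
        P = flatIdeal W F} := by
  ext P
  constructor
  · rintro ⟨⟨hprime, hann⟩, hmin⟩
    obtain ⟨F, hFP, hF, hne⟩ := hW.exists_isCyclicFlat_subset hann
    have eq_flatIdeal : ∀ G, IsCyclicFlat M G → G.Nonempty → G ⊆ F → P = flatIdeal W G := by
      intro G hG hGne hGF
      have hle := flatIdeal_le_iff.2 (hGF.trans hFP)
      exact (hmin ⟨isPrime_flatIdeal W G,
        hW.annihilator_quotSlice_le_flatIdeal hG hGne⟩ hle).antisymm hle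
    refine ⟨F, ⟨⟨hF, hne⟩, fun G ⟨hG, hGne⟩ hGF => ?_⟩, eq_flatIdeal F hF hne subset_rfl⟩
    rwa [eq_flatIdeal G hG hGne hGF, hW.setOf_coord_mem_flatIdeal hG.1] at hFP
  · rintro ⟨F, ⟨⟨hF, hne⟩, hmin⟩, rfl⟩
    refine ⟨⟨isPrime_flatIdeal W F, hW.annihilator_quotSlice_le_flatIdeal hF hne⟩, ?_⟩
    rintro Q ⟨hprime, hann⟩ hQ
    obtain ⟨G, hGQ, hG⟩ := hW.exists_isCyclicFlat_subset hann
    have hGF : G ⊆ F := fun i hi => (hW.setOf_coord_mem_flatIdeal hF.1).subset (hQ (hGQ hi))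
    exact flatIdeal_le_iff.2 ((hmin hG hGF).trans hGQ)

end IsRealization

end Conclusion

end IdealOfPairs

end

theorem corollary3p10_general {ι k : Type*} [Fintype ι] [Field k] (M : Matroid ι)
    (W : Submodule k (ι → k)) (hW : IdealOfPairs.IsRealization M W) :
    associatedPrimes (IdealOfPairs.CoordRing W) (IdealOfPairs.quotSlice W 1) ⊆
        {P | ∃ F : Set ι, F.Nonempty ∧ M.IsFlat F ∧ P = IdealOfPairs.flatIdeal W F} ∧
      IdealOfPairs.moduleMinimalPrimes (IdealOfPairs.CoordRing W) (IdealOfPairs.quotSlice W 1) =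
        {P | ∃ F : Set ι,
          Minimal (fun G => IdealOfPairs.IsCyclicFlat M G ∧ G.Nonempty) F ∧
            P = IdealOfPairs.flatIdeal W F} :=
  ⟨hW.associatedPrimes_quotSlice_subset, hW.moduleMinimalPrimes_quotSlice⟩

theorem corollary3p10 {k : Type*} [Field k] (n : ℕ) (M : Matroid (Fin n))
    (W : Submodule k (Fin n → k)) (hW : IdealOfPairs.IsRealization M W)
    (hloop : ∀ i, ¬ M.IsLoop i) (hcoloop : ∀ i, ¬ M.IsColoop i) :
    associatedPrimes (IdealOfPairs.CoordRing W) (IdealOfPairs.quotSlice W 1) ⊆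
        {P | ∃ F : Set (Fin n), F.Nonempty ∧ M.IsFlat F ∧ P = IdealOfPairs.flatIdeal W F} ∧
      IdealOfPairs.moduleMinimalPrimes (IdealOfPairs.CoordRing W) (IdealOfPairs.quotSlice W 1) =
        {P | ∃ F : Set (Fin n),
          Minimal (fun G => IdealOfPairs.IsCyclicFlat M G ∧ G.Nonempty) F ∧
            P = IdealOfPairs.flatIdeal W F} :=
  corollary3p10_general M W hW
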